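/- All vector spaces are complex, and lcHs means locally convex Hausdorff topological vector space. An inductive spectrum of Banach spaces is a sequence $(Z_n)_{n\in\mathbb N}$ of Banach spaces with $Z_n\subseteq Z_{n+1}$ and continuous inclusion maps; it defines $Z$, written $Z=\operatorname{Ind}(Z_n)_n$, if $Z=\bigcup_n Z_n$ carries the finest locally convex topology for which all inclusions $Z_n\to Z$ are continuous. An $(LB)$-space is a lcHs $Z$ that is defined by some inductive spectrum of Banach spaces. $L(X,E)$ denotes the vector space of continuous linear maps $X\to E$. A sequence $0\to X\xrightarrow{\iota} Y\xrightarrow{Q} Z\to 0$ is exact if $\iota,Q$ are continuous and linear and the sequence is algebraically exact. Let $E$ be a lcHs. - An $(LB)$-space $Z$ is weakly $E$-acyclic if for every exact sequence $0\to X\xrightarrow{\iota} Y\xrightarrow{Q} Z\to 0$ of $(LB)$-spaces the map $L(Y,E)\to L(X,E)$, $T\mapsto T\circ\iota$, is surjective. - A Banach space $H$ is weakly $E$-acyclic in the category of Banach spaces if for every exact sequence $0\to F\xrightarrow{\iota} G\to H\to 0$ of Banach spaces the map $L(G,E)\to L(F,E)$, $T\mapsto T\circ\iota$, is surjective. - An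 $(LB)$-space $Z$ is locally weakly $E$-acyclic if $Z=\operatorname{Ind}(W_n)_n$ for some inductive spectrum of Banach spaces $(W_n)_n$ such that each inclusion $W_n\to W_{n+1}$ is of the form $b\circ a$ with $a\in L(W_n,H)$, $b\in L(H,W_{n+1})$, where $H$ is a Banach space (depending on $n$) that is weakly $E$-acyclic in the category of Banach spaces. - For an inductive spectrum of Banach spaces $\mathscr Z=(Z_n)_n$, let $\mathscr L(\mathscr Z,E)$ be the projective spectrum $(L(Z_n,E))_n$ with the restriction maps $T\mapsto T|_{Z_n}$, and let $$\operatorname{Proj}^1\mathscr L(\mathscr Z,E)=\Big(\prod_n L(Z_n,E)\Big)\Big/\Big\{(T_n-T_{n+1}|_{Z_n})_n : (T_n)_n\in\prod_n L(Z_n,E)\Big\}.$$ **Theorem.** Let $E$ be a lcHs, let $Z$ be a locally weakly $E$-acyclic $(LB)$-space, and let $\mathscr Z$ be any inductive spectrum of Banach spaces with $Z=\operatorname{Ind}\mathscr Z$. Then $Z$ is weakly $E$-acyclic if and only if $\operatorname{Proj}^1\mathscr L(\mathscr Z,E)=0$. -/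

import Mathlib

universe u v w

/-- A projective spectrum (of vector spaces): complex vector spaces `X n` with linear maps `X m → X n` for `n ≤ m`. -/
structure ProjectiveSequence where
  space : ℕ → Type w
  [addCommGroup : ∀ n, AddCommGroup (space n)]
  [module : ∀ n, Module ℂ (space n)]
  map : ∀ {n m : ℕ}, n ≤ m → space m →ₗ[ℂ] space n
  map_refl : ∀ (n : ℕ) (x : space n), map (le_refl n) x = x
  map_map : ∀ {n m k : ℕ} (h : n ≤ m) (h' : m ≤ k) (x : space k),
    map h (map h' x) = map (h.trans h') x

namespace ProjectiveSequence

attribute [instance] addCommGroup module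

/-- The map `Ψ : (x n) ↦ (x n - ϱ (x (n + 1)))` on the product of the spaces of the spectrum. -/
def psi (X : ProjectiveSequence.{w}) : (∀ n, X.space n) →ₗ[ℂ] (∀ n, X.space n) :=
  LinearMap.pi fun n => LinearMap.proj n - X.map (Nat.le_succ n) ∘ₗ LinearMap.proj (n + 1)

/-- The first derived projective limit, the cokernel of `Ψ`. -/
abbrev Proj1 (X : ProjectiveSequence.{w}) : Type w :=
  (∀ n, X.space n) ⧸ LinearMap.range X.psi

end ProjectiveSequence

/-- `t` is a locally convex vector space topology on `Z` (Hausdorff or not). -/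
structure IsLocallyConvexTopology (Z : Type u) [AddCommGroup Z] [Module ℂ Z]
    (t : TopologicalSpace Z) : Prop where
  isTopologicalAddGroup : @IsTopologicalAddGroup Z t _
  continuousSMul : @ContinuousSMul ℂ Z _ _ t
  locallyConvexSpace : @LocallyConvexSpace ℝ Z _ _ _ _ t

/-- An inductive spectrum of Banach spaces whose union is the vector space `Z`. The spaces are
given together with injective linear maps `toUnion n` into `Z`, through which they are regarded
as subspaces of `Z`; `incl` are then the inclusion maps, required to be continuous. -/
structure BanachSpectrum (Z : Type u) [AddCommGroup Z] [Module ℂ Z] where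
  space : ℕ → Type u
  [normedAddCommGroup : ∀ n, NormedAddCommGroup (space n)]
  [normedSpace : ∀ n, NormedSpace ℂ (space n)]
  [completeSpace : ∀ n, CompleteSpace (space n)]
  toUnion : ∀ n, space n →ₗ[ℂ] Z
  injective_toUnion : ∀ n, Function.Injective (toUnion n)
  exists_toUnion_eq : ∀ z : Z, ∃ n, ∃ x : space n, toUnion n x = z
  incl : ∀ {n m : ℕ}, n ≤ m → space n →L[ℂ] space m
  toUnion_incl : ∀ {n m : ℕ} (h : n ≤ m) (x : space n), toUnion m (incl h x) = toUnion n x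

namespace BanachSpectrum

attribute [instance] normedAddCommGroup normedSpace completeSpace

/-- `Z = Ind S`: the topology of `Z` is the finest locally convex topology for which all inclusion
maps into `Z` are continuous. (In Mathlib's order on topologies the finest one is the least.) -/
def IsDefining {Z : Type u} [AddCommGroup Z] [Module ℂ Z] [τ : TopologicalSpace Z]
    (S : BanachSpectrum Z) : Prop :=
  IsLeast {t : TopologicalSpace Z | IsLocallyConvexTopology Z t ∧
    ∀ n, @Continuous (S.space n) Z _ t (S.toUnion n)} τ

theorem incl_refl {Z : Type u} [AddCommGroup Z] [Module ℂ Z] (S : BanachSpectrum Z)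
    (n : ℕ) (x : S.space n) : S.incl (le_refl n) x = x :=
  S.injective_toUnion n (S.toUnion_incl _ x)

theorem incl_incl {Z : Type u} [AddCommGroup Z] [Module ℂ Z] (S : BanachSpectrum Z)
    {n m k : ℕ} (h : n ≤ m) (h' : m ≤ k) (x : S.space n) :
    S.incl h' (S.incl h x) = S.incl (h.trans h') x :=
  S.injective_toUnion k (by simp only [S.toUnion_incl])

/-- The projective spectrum `(L(Z n, E))` with the restriction maps `T ↦ T|_{Z n}`. -/
def homSpectrum {Z : Type u} [AddCommGroup Z] [Module ℂ Z] (S : BanachSpectrum Z)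
    (E : Type v) [AddCommGroup E] [Module ℂ E] [TopologicalSpace E] [IsTopologicalAddGroup E]
    [ContinuousSMul ℂ E] : ProjectiveSequence.{max u v} where
  space n := S.space n →L[ℂ] E
  map {n m} h :=
    { toFun := fun T => T.comp (S.incl h)
      map_add' := fun T T' => ContinuousLinearMap.add_comp T T' (S.incl h)
      map_smul' := fun c T => ContinuousLinearMap.smul_comp c T (S.incl h) }
  map_refl n T := by
    ext x
    exact congrArg T (S.incl_refl n x)
  map_map {n m k} h h' T := by
    ext x
    exact congrArg T (S.incl_incl h h' x)

end BanachSpectrum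

/-- `(LB)`-spaces: Hausdorff inductive limits of inductive spectra of Banach spaces. -/
def IsLBSpace (Z : Type u) [AddCommGroup Z] [Module ℂ Z] [TopologicalSpace Z] : Prop :=
  T2Space Z ∧ ∃ S : BanachSpectrum Z, S.IsDefining

/-- For an `(LB)`-space `Z`: for every exact sequence `0 → X → Y → Z → 0` of `(LB)`-spaces, the map
`L(Y, E) → L(X, E)`, `S ↦ S ∘ ι` is surjective. -/
def IsWeaklyAcyclic (E : Type v) [AddCommGroup E] [Module ℂ E] [TopologicalSpace E]
    (Z : Type u) [AddCommGroup Z] [Module ℂ Z] [TopologicalSpace Z] : Prop :=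
  ∀ (X Y : Type u) [AddCommGroup X] [Module ℂ X] [TopologicalSpace X]
    [AddCommGroup Y] [Module ℂ Y] [TopologicalSpace Y] (ι : X →L[ℂ] Y) (Q : Y →L[ℂ] Z),
    IsLBSpace X → IsLBSpace Y →
    Function.Injective ι → Function.Exact ι Q → Function.Surjective Q →
    Function.Surjective fun T : Y →L[ℂ] E => T.comp ι

/-- Weak `E`-acyclicity of `H` in the category of Banach spaces: the same for exact sequences
`0 → F → G → H → 0` of Banach spaces. -/
def IsWeaklyAcyclicBanach (E : Type v) [AddCommGroup E] [Module ℂ E] [TopologicalSpace E]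
    (H : Type u) [NormedAddCommGroup H] [NormedSpace ℂ H] : Prop :=
  ∀ (F G : Type u) [NormedAddCommGroup F] [NormedSpace ℂ F] [CompleteSpace F]
    [NormedAddCommGroup G] [NormedSpace ℂ G] [CompleteSpace G] (ι : F →L[ℂ] G) (Q : G →L[ℂ] H),
    Function.Injective ι → Function.Exact ι Q → Function.Surjective Q →
    Function.Surjective fun T : G →L[ℂ] E => T.comp ι

/-- For an `(LB)`-space `Z`: some defining spectrum `(Z n)` of Banach spaces is such that each
inclusion `Z n → Z (n + 1)` factors through a Banach space that is weakly `E`-acyclic in the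
category of Banach spaces. -/
def IsLocallyWeaklyAcyclic (E : Type v) [AddCommGroup E] [Module ℂ E] [TopologicalSpace E]
    (Z : Type u) [AddCommGroup Z] [Module ℂ Z] [TopologicalSpace Z] : Prop :=
  ∃ S : BanachSpectrum Z, S.IsDefining ∧ ∀ n : ℕ,
    ∃ (H : Type u) (_ : NormedAddCommGroup H) (_ : NormedSpace ℂ H) (_ : CompleteSpace H),
      IsWeaklyAcyclicBanach E H ∧
      ∃ (a : S.space n →L[ℂ] H) (b : H →L[ℂ] S.space (n + 1)),
        S.incl (Nat.le_succ n) = b.comp a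

/-! Necessity: `Z` is the cokernel of identity minus shift on the direct sum of the `Z n`, an exact
sequence of (LB)-spaces (`exact_diffMap_sumMap`). A continuous map from the direct sum to `E` is a
family in `∏ L(Z n, E)`, and composition with `diffMap` becomes `Ψ`. Extending along `diffMap`
therefore means solving `Ψ U = R`.

Sufficiency: given `0 → X → Y → Z → 0` and `f` on `X`, pull the sequence back to Banach spaces.
Grothendieck's factorization theorem gives Banach fibre products `P n` of a step of `Y` and `Z n`
over `Z`, with `P n → Z n` onto. Since `Z n → Z` passes through an acyclic Banach space, `f` extends
to some `T n` on `P n`. On the kernel of `P n → Z n` both `T n` and `T (n + 1)` restrict to `f`, so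
their difference descends to `R n` on `Z n`. Writing `R n = U n - U (n + 1)` on `Z n`, the corrected
maps `T n - U n` agree on overlaps and glue to an extension on `Y`, the union of the `P n`. -/

open Filter Topology

/-! ### Open mapping, fibre products and Grothendieck factorization -/

section Factorization

variable {A B Z : Type*} [NormedAddCommGroup A] [NormedSpace ℂ A] [NormedAddCommGroup B]
  [NormedSpace ℂ B] [AddCommGroup Z] [Module ℂ Z] [TopologicalSpace Z]

/-- A bounded operator on a Banach space for which every point has an approximate preimage of
controlled norm is onto. -/
theorem ContinuousLinearMap.surjective_of_approx [CompleteSpace A] (f : A →L[ℂ] B) (C : ℝ)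
    (hf : ∀ y, ∃ x, ‖y - f x‖ ≤ 1 / 2 * ‖y‖ ∧ ‖x‖ ≤ C * ‖y‖) : Function.Surjective f := by
  choose g hg hgC using hf
  intro y
  -- Successive residuals: each approximate preimage at least halves the error, so the corrections
  -- sum to an exact preimage.
  let r : ℕ → B := fun n => (fun z => z - f (g z))^[n] y
  have r_succ (n : ℕ) : r (n + 1) = r n - f (g (r n)) := Function.iterate_succ_apply' ..
  have hr (n : ℕ) : ‖r n‖ ≤ (1 / 2) ^ n * ‖y‖ := by
    induction n with
    | zero => simp [r]
    | succ n ih =>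
      rw [r_succ, pow_succ', mul_assoc]
      exact (hg _).trans (by gcongr)
  have hr0 : Tendsto r atTop (𝓝 0) := by
    refine squeeze_zero_norm hr ?_
    simpa using (tendsto_pow_atTop_nhds_zero_of_lt_one (r := (1 / 2 : ℝ))
      (by norm_num) (by norm_num)).mul_const ‖y‖
  have hsum : Summable fun n => g (r n) := by
    refine Summable.of_norm_bounded (g := fun n : ℕ => (1 / 2 : ℝ) ^ n * (|C| * ‖y‖))
      (summable_geometric_two.mul_right _) fun n => ?_
    calc ‖g (r n)‖ ≤ C * ‖r n‖ := hgC _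
      _ ≤ |C| * ((1 / 2) ^ n * ‖y‖) := by gcongr; exacts [le_abs_self C, hr n]
      _ = _ := by ring
  have hpart (n : ℕ) : f (∑ i ∈ Finset.range n, g (r i)) = y - r n := by
    induction n with
    | zero => simp [r]
    | succ n ih => rw [Finset.sum_range_succ, map_add, ih, r_succ]; abel
  refine ⟨∑' n, g (r n), tendsto_nhds_unique
    ((f.continuous.tendsto _).comp hsum.hasSum.tendsto_sum_nat) ?_⟩
  simpa [Function.comp_def, hpart] using (tendsto_const_nhds (x := y)).sub hr0

/-- The open mapping theorem for a countable family of bounded operators: if their ranges cover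
the target, one of them is onto. -/
theorem ContinuousLinearMap.exists_surjective_of_cover [CompleteSpace B] {D : ℕ → Type*}
    [∀ n, NormedAddCommGroup (D n)] [∀ n, NormedSpace ℂ (D n)] [∀ n, CompleteSpace (D n)]
    (f : ∀ n, D n →L[ℂ] B) (hf : ∀ y, ∃ n x, f n x = y) : ∃ n, Function.Surjective (f n) := by
  have hcover : ⋃ p : ℕ × ℕ, closure (f p.1 '' Metric.ball 0 p.2) = Set.univ := by
    refine Set.eq_univ_of_forall fun y => ?_
    obtain ⟨n, x, rfl⟩ := hf y
    obtain ⟨k, hk⟩ := exists_nat_gt ‖x‖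
    exact Set.mem_iUnion.2 ⟨(n, k), subset_closure ⟨x, by simpa using hk, rfl⟩⟩
  -- Baire category: the closure of one of the images contains a ball.
  obtain ⟨⟨n, k⟩, a, ha⟩ :=
    nonempty_interior_of_iUnion_of_closed (fun _ => isClosed_closure) hcover
  obtain ⟨ε, hε, hball⟩ := Metric.mem_nhds_iff.1 (mem_interior_iff_mem_nhds.1 ha)
  refine ⟨n, (f n).surjective_of_approx (4 * k / ε) fun y => ?_⟩
  rcases eq_or_ne y 0 with rfl | hy
  · exact ⟨0, by simp⟩
  have hy' : 0 < ‖y‖ := norm_pos_iff.2 hy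
  have approx (z : B) (hz : z ∈ Metric.ball a ε) : ∃ x, ‖x‖ < k ∧ ‖z - f n x‖ < ε / 8 := by
    obtain ⟨_, ⟨x, hx, rfl⟩, hxz⟩ := Metric.mem_closure_iff.1 (hball hz) (ε / 8) (by positivity)
    exact ⟨x, by simpa using hx, by rwa [dist_eq_norm] at hxz⟩
  -- Scales `y` to norm `ε / 2`, keeping `a + t • y` in the ball. The two errors `ε / 8` add up to
  -- `ε / 4`, half of that norm.
  let t : ℝ := ε / (2 * ‖y‖)
  have ht : 0 < t := by positivity
  have hnorm : ‖(t : ℂ)‖ = t := by simp [abs_of_pos ht]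
  have ht0 : (t : ℂ) ≠ 0 := by exact_mod_cast ht.ne'
  obtain ⟨x₁, hx₁, h₁⟩ := approx (a + (t : ℂ) • y) (by
    rw [mem_ball_iff_norm, add_sub_cancel_left, norm_smul, hnorm]
    simp only [t]; field_simp; linarith)
  obtain ⟨x₂, hx₂, h₂⟩ := approx a (Metric.mem_ball_self hε)
  have key : ‖(t : ℂ) • y - f n (x₁ - x₂)‖ ≤ ε / 4 := by
    calc ‖(t : ℂ) • y - f n (x₁ - x₂)‖
        = ‖(a + (t : ℂ) • y - f n x₁) - (a - f n x₂)‖ := by rw [map_sub]; congr 1; abel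
      _ ≤ ‖a + (t : ℂ) • y - f n x₁‖ + ‖a - f n x₂‖ := norm_sub_le _ _
      _ ≤ ε / 4 := by linarith
  refine ⟨(t : ℂ)⁻¹ • (x₁ - x₂), ?_, ?_⟩
  · calc ‖y - f n ((t : ℂ)⁻¹ • (x₁ - x₂))‖
        = ‖(t : ℂ)⁻¹ • ((t : ℂ) • y - f n (x₁ - x₂))‖ := by
          rw [smul_sub _ (_ • y), inv_smul_smul₀ ht0, map_smul]
      _ = t⁻¹ * ‖(t : ℂ) • y - f n (x₁ - x₂)‖ := by rw [norm_smul, norm_inv, hnorm]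
      _ ≤ t⁻¹ * (ε / 4) := by gcongr
      _ = 1 / 2 * ‖y‖ := by simp only [t]; field_simp; norm_num
  · calc ‖(t : ℂ)⁻¹ • (x₁ - x₂)‖ = t⁻¹ * ‖x₁ - x₂‖ := by rw [norm_smul, norm_inv, hnorm]
      _ ≤ t⁻¹ * (k + k) := by
        gcongr
        exact (norm_sub_le _ _).trans (by gcongr)
      _ = 4 * k / ε * ‖y‖ := by simp only [t]; field_simp; ring

/-- The fibre product of `A` and `B` over `Z`. -/
def fibreProduct (f : A →L[ℂ] Z) (g : B →L[ℂ] Z) : Submodule ℂ (A × B) :=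
  LinearMap.eqLocus (f.comp (ContinuousLinearMap.fst ℂ A B)).toLinearMap
    (g.comp (ContinuousLinearMap.snd ℂ A B)).toLinearMap

theorem mem_fibreProduct {f : A →L[ℂ] Z} {g : B →L[ℂ] Z} {p : A × B} :
    p ∈ fibreProduct f g ↔ f p.1 = g p.2 :=
  Iff.rfl

instance [CompleteSpace A] [CompleteSpace B] [T2Space Z] (f : A →L[ℂ] Z) (g : B →L[ℂ] Z) :
    CompleteSpace (fibreProduct f g) :=
  IsClosed.completeSpace_coe (hs := isClosed_eq (f.continuous.comp continuous_fst)
    (g.continuous.comp continuous_snd))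

namespace fibreProduct

/-- The first projection of a fibre product. -/
def fst (f : A →L[ℂ] Z) (g : B →L[ℂ] Z) : fibreProduct f g →L[ℂ] A :=
  (ContinuousLinearMap.fst ℂ A B).comp (fibreProduct f g).subtypeL

/-- The second projection of a fibre product. -/
def snd (f : A →L[ℂ] Z) (g : B →L[ℂ] Z) : fibreProduct f g →L[ℂ] B :=
  (ContinuousLinearMap.snd ℂ A B).comp (fibreProduct f g).subtypeL

@[simp]
theorem snd_apply {f : A →L[ℂ] Z} {g : B →L[ℂ] Z} (p : fibreProduct f g) :
    snd f g p = p.1.2 :=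
  rfl

/-- The map into a fibre product given by its two components. -/
def lift {D : Type*} [NormedAddCommGroup D] [NormedSpace ℂ D] (f : A →L[ℂ] Z) (g : B →L[ℂ] Z)
    (φ : D →L[ℂ] A) (ψ : D →L[ℂ] B) (h : ∀ d, f (φ d) = g (ψ d)) : D →L[ℂ] fibreProduct f g :=
  (φ.prod ψ).codRestrict _ h

end fibreProduct

/-- Grothendieck's factorization theorem, on the level of ranges. -/
theorem exists_forall_exists_eq [T2Space Z] [CompleteSpace B] {C : ℕ → Type*}
    [∀ n, NormedAddCommGroup (C n)] [∀ n, NormedSpace ℂ (C n)] [∀ n, CompleteSpace (C n)]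
    (g : B →L[ℂ] Z) (c : ∀ n, C n →L[ℂ] Z) (h : ∀ b, ∃ n x, c n x = g b) :
    ∃ n, ∀ b, ∃ x, c n x = g b := by
  -- The fibre products of `C n` and `B` are Banach because `Z` is Hausdorff, and their projections
  -- cover `B`.
  obtain ⟨n, hn⟩ := ContinuousLinearMap.exists_surjective_of_cover
    (fun n => fibreProduct.snd (c n) g) fun b => by
      obtain ⟨n, x, hx⟩ := h b
      exact ⟨n, ⟨(x, b), hx⟩, rfl⟩
  refine ⟨n, fun b => ?_⟩
  obtain ⟨p, rfl⟩ := hn b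
  exact ⟨p.1.1, p.2⟩

/-- Grothendieck's factorization theorem. -/
theorem exists_factorization [T2Space Z] [CompleteSpace B] {C : ℕ → Type*}
    [∀ n, NormedAddCommGroup (C n)] [∀ n, NormedSpace ℂ (C n)] [∀ n, CompleteSpace (C n)]
    (g : B →L[ℂ] Z) (c : ∀ n, C n →L[ℂ] Z) (hc : ∀ n, Function.Injective (c n))
    (h : ∀ b, ∃ n x, c n x = g b) :
    ∃ n, ∃ φ : B →L[ℂ] C n, ∀ b, c n (φ b) = g b := by
  obtain ⟨n, hn⟩ := exists_forall_exists_eq g c h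
  choose φ hφ using hn
  let φ' : B →ₗ[ℂ] C n :=
    { toFun := φ
      map_add' := fun x y => hc n (by simp only [map_add, hφ])
      map_smul' := fun a x => hc n (by simp only [map_smul, hφ, RingHom.id_apply]) }
  -- The graph is cut out by an equation in the Hausdorff space `Z`, so the closed graph theorem
  -- applies.
  have hgraph : (φ'.graph : Set (B × C n)) = {p | c n p.2 = g p.1} := by
    ext p
    simp only [SetLike.mem_coe, LinearMap.mem_graph_iff, Set.mem_ofPred_eq, ← hφ, (hc n).eq_iff]
    rfl
  refine ⟨n, ⟨φ', φ'.continuous_of_isClosed_graph ?_⟩, hφ⟩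
  rw [hgraph]
  exact isClosed_eq ((c n).continuous.comp continuous_snd) (g.continuous.comp continuous_fst)

/-- A continuous linear map vanishing on the kernel of a surjection of Banach spaces factors
through it. -/
theorem exists_comp_eq_of_surjective [CompleteSpace A] [CompleteSpace B] {E : Type*}
    [AddCommGroup E] [Module ℂ E] [TopologicalSpace E] (π : A →L[ℂ] B)
    (hπ : Function.Surjective π) (D : A →L[ℂ] E) (hD : ∀ x, π x = 0 → D x = 0) :
    ∃ R : B →L[ℂ] E, ∀ x, R (π x) = D x := by
  -- The section `s` is only linear; continuity of `D ∘ s` comes from `π` being a quotient map.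
  obtain ⟨s, hs⟩ := LinearMap.exists_rightInverse_of_surjective π.toLinearMap
    (LinearMap.range_eq_top.2 hπ)
  have hs' (y : B) : π (s y) = y := LinearMap.congr_fun hs y
  have key (x : A) : D (s (π x)) = D x := by
    rw [← sub_eq_zero, ← map_sub]
    exact hD _ (by rw [map_sub, hs', sub_self])
  refine ⟨⟨D.toLinearMap ∘ₗ s, (π.isQuotientMap hπ).continuous_iff.2 ?_⟩, key⟩
  exact D.continuous.congr fun x => (key x).symm

end Factorization

/-! ### Locally convex topologies and defining spectra -/

theorem IsLocallyConvexTopology.sInf {Z : Type*} [AddCommGroup Z] [Module ℂ Z]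
    {T : Set (TopologicalSpace Z)} (hT : ∀ t ∈ T, IsLocallyConvexTopology Z t) :
    IsLocallyConvexTopology Z (sInf T) where
  isTopologicalAddGroup := topologicalAddGroup_sInf fun t ht => (hT t ht).isTopologicalAddGroup
  continuousSMul := continuousSMul_sInf fun t ht => (hT t ht).continuousSMul
  locallyConvexSpace := LocallyConvexSpace.sInf fun t ht => (hT t ht).locallyConvexSpace

theorem IsLocallyConvexTopology.induced {Z E : Type*} [AddCommGroup Z] [Module ℂ Z]
    [AddCommGroup E] [Module ℂ E] [TopologicalSpace E] [IsTopologicalAddGroup E]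
    [ContinuousSMul ℂ E] [LocallyConvexSpace ℝ E] (g : Z →ₗ[ℂ] E) :
    IsLocallyConvexTopology Z (TopologicalSpace.induced g inferInstance) where
  isTopologicalAddGroup := topologicalAddGroup_induced g
  continuousSMul := continuousSMul_induced g
  locallyConvexSpace := LocallyConvexSpace.induced (g.restrictScalars ℝ)

namespace BanachSpectrum

section

variable {Z : Type u} [AddCommGroup Z] [Module ℂ Z]

theorem exists_isDefining (S : BanachSpectrum Z) :
    ∃ τ : TopologicalSpace Z, S.IsDefining (τ := τ) :=
  ⟨sInf {t | IsLocallyConvexTopology Z t ∧ ∀ n, @Continuous (S.space n) Z _ t (S.toUnion n)},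
    ⟨IsLocallyConvexTopology.sInf fun _ ht => ht.1,
      fun n => continuous_sInf_rng.2 fun _ ht => ht.2 n⟩, fun _ ht => sInf_le ht⟩

variable [TopologicalSpace Z] {S : BanachSpectrum Z}

/-- The inclusion of a step of a defining spectrum, as a continuous linear map. -/
def IsDefining.toUnionL (hS : S.IsDefining) (n : ℕ) : S.space n →L[ℂ] Z :=
  ⟨S.toUnion n, hS.1.2 n⟩

@[simp]
theorem IsDefining.toUnionL_apply (hS : S.IsDefining) (n : ℕ) (x : S.space n) :
    hS.toUnionL n x = S.toUnion n x :=
  rfl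

/-- The topology induced by `g` is one of the competitors, so the finest one refines it. -/
theorem IsDefining.continuous_of_comp (hS : S.IsDefining) {E : Type*} [AddCommGroup E]
    [Module ℂ E] [TopologicalSpace E] [IsTopologicalAddGroup E] [ContinuousSMul ℂ E]
    [LocallyConvexSpace ℝ E] (g : Z →ₗ[ℂ] E)
    (hg : ∀ n, Continuous fun x : S.space n => g (S.toUnion n x)) : Continuous g :=
  continuous_iff_le_induced.2
    (hS.2 ⟨IsLocallyConvexTopology.induced g, fun n => continuous_induced_rng.2 (hg n)⟩)

/-- A continuous linear map from a Banach space, with values in a Hausdorff inductive limit of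
Banach spaces, factors through one of the steps. -/
theorem IsDefining.exists_factorization [T2Space Z] (hS : S.IsDefining) {B : Type*}
    [NormedAddCommGroup B] [NormedSpace ℂ B] [CompleteSpace B] (g : B →L[ℂ] Z) :
    ∃ n, ∃ φ : B →L[ℂ] S.space n, ∀ b, S.toUnion n (φ b) = g b :=
  _root_.exists_factorization g hS.toUnionL S.injective_toUnion fun b => S.exists_toUnion_eq (g b)

end

/-! ### The direct sum of the steps and the canonical resolution -/

section DirectSum

variable {Z : Type u} [AddCommGroup Z] [Module ℂ Z] (S : BanachSpectrum Z)

/-- The algebraic direct sum of the steps of a spectrum. -/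
abbrev DirectSum : Type u :=
  Π₀ n, S.space n

/-- The inclusion of the sum of the first `n` steps into the direct sum. -/
def finiteSum (n : ℕ) : (∀ i : Fin n, S.space i) →ₗ[ℂ] S.DirectSum :=
  ∑ i : Fin n, DFinsupp.lsingle (i : ℕ) ∘ₗ LinearMap.proj i

theorem finiteSum_apply (n : ℕ) (x : ∀ i : Fin n, S.space i) (k : ℕ) :
    S.finiteSum n x k = if h : k < n then x ⟨k, h⟩ else 0 := by
  simp only [finiteSum, LinearMap.sum_apply, LinearMap.comp_apply, LinearMap.proj_apply,
    DFinsupp.finsetSum_apply, DFinsupp.lsingle_apply]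
  split_ifs with h
  · rw [Finset.sum_eq_single ⟨k, h⟩]
    · simp
    · intro i _ hi
      exact DFinsupp.single_eq_of_ne (fun e => hi (Fin.ext e.symm))
    · simp
  · exact Finset.sum_eq_zero fun i _ => DFinsupp.single_eq_of_ne (fun e => h (e ▸ i.2))

/-- The direct sum of the steps, as the union of the finite direct sums. -/
noncomputable def directSumSpectrum : BanachSpectrum S.DirectSum where
  space n := ∀ i : Fin n, S.space i
  toUnion := S.finiteSum
  injective_toUnion n x y h := by
    ext i
    simpa [finiteSum_apply] using DFunLike.congr_fun h (i : ℕ)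
  exists_toUnion_eq z := by
    classical
    -- The `n`-th finite sum uses the indices below `n`, hence the `+ 1`.
    refine ⟨z.support.sup id + 1, fun i => z i, ?_⟩
    ext k
    rw [finiteSum_apply]
    split_ifs with h
    · rfl
    · by_contra hk
      exact h (Nat.lt_succ_of_le (Finset.le_sup (f := id)
        ((DFinsupp.mem_support_iff).2 (Ne.symm hk))))
  incl {n m} _ := ContinuousLinearMap.pi fun i =>
    if h : (i : ℕ) < n then ContinuousLinearMap.proj (⟨i, h⟩ : Fin n) else 0
  toUnion_incl {n m} h x := by
    ext k
    simp only [finiteSum_apply, ContinuousLinearMap.pi_apply]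
    split_ifs <;> first | rfl | omega

variable {S}

theorem continuous_of_continuous_single [TopologicalSpace S.DirectSum]
    (h : S.directSumSpectrum.IsDefining) {E : Type*} [AddCommGroup E]
    [Module ℂ E] [TopologicalSpace E] [IsTopologicalAddGroup E] [ContinuousSMul ℂ E]
    [LocallyConvexSpace ℝ E] (g : S.DirectSum →ₗ[ℂ] E)
    (hg : ∀ n, Continuous fun x : S.space n => g (DFinsupp.single n x)) : Continuous g := by
  refine h.continuous_of_comp g fun n => ?_
  change Continuous fun x : (∀ i : Fin n, S.space i) => g (S.finiteSum n x)
  simp only [finiteSum, LinearMap.sum_apply, LinearMap.comp_apply, LinearMap.proj_apply,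
    DFinsupp.lsingle_apply, map_sum]
  exact continuous_finsetSum _ fun i _ => (hg i).comp (continuous_apply i)

theorem continuous_single [TopologicalSpace S.DirectSum]
    (h : S.directSumSpectrum.IsDefining) (n : ℕ) :
    Continuous fun x : S.space n => (DFinsupp.single n x : S.DirectSum) := by
  have hc : Continuous fun x : S.space n =>
      S.finiteSum (n + 1) (fun i => if e : n = i then e ▸ x else 0) := by
    refine (h.1.2 (n + 1)).comp (continuous_pi fun i => ?_)
    split_ifs with e
    · obtain ⟨i, hi⟩ := i
      obtain rfl : n = i := e
      exact continuous_id
    · exact continuous_const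
  refine hc.congr fun x => ?_
  ext k
  rw [finiteSum_apply]
  rcases eq_or_ne n k with rfl | hk
  · simp
  · simp [DFinsupp.single_eq_of_ne hk.symm, hk]

/-- The Hausdorff property comes from the continuous injection into the full product. -/
theorem isLBSpace_directSum [TopologicalSpace S.DirectSum]
    (h : S.directSumSpectrum.IsDefining) : IsLBSpace S.DirectSum := by
  refine ⟨?_, _, h⟩
  have hc : Continuous fun z : S.DirectSum => fun n => z n := by
    refine continuous_pi fun n => ?_
    refine continuous_of_continuous_single h (DFinsupp.lapply (R := ℂ) n) fun m => ?_
    rcases eq_or_ne m n with rfl | hmn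
    · simpa using continuous_id'
    · simpa [DFinsupp.single_eq_of_ne hmn.symm] using continuous_const
  exact T2Space.of_injective_continuous DFunLike.coe_injective hc

variable (S)

/-- The summation map from the direct sum of the steps onto the union. -/
noncomputable def sumMap : S.DirectSum →ₗ[ℂ] Z :=
  DFinsupp.lsum ℕ S.toUnion

/-- The map whose cokernel is the union: the difference of the identity and the shift along the
inclusions. -/
noncomputable def diffMap : S.DirectSum →ₗ[ℂ] S.DirectSum :=
  DFinsupp.lsum ℕ fun n =>
    DFinsupp.lsingle n - DFinsupp.lsingle (n + 1) ∘ₗ (S.incl (Nat.le_succ n)).toLinearMap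

theorem directSum_induction {S : BanachSpectrum Z} {p : S.DirectSum → Prop} (z : S.DirectSum)
    (zero : p 0) (add : ∀ f g, p f → p g → p (f + g))
    (single : ∀ n (x : S.space n), p (DFinsupp.single n x)) : p z :=
  DFinsupp.induction z zero fun n x _ _ _ hf => add _ _ (single n x) hf

@[simp]
theorem sumMap_single (n : ℕ) (x : S.space n) :
    S.sumMap (DFinsupp.single n x) = S.toUnion n x := by
  simp [sumMap]

@[simp]
theorem diffMap_single (n : ℕ) (x : S.space n) :
    S.diffMap (DFinsupp.single n x) =
      DFinsupp.single n x - DFinsupp.single (n + 1) (S.incl (Nat.le_succ n) x) := by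
  simp [diffMap]

theorem sumMap_surjective : Function.Surjective S.sumMap := fun z => by
  obtain ⟨n, x, rfl⟩ := S.exists_toUnion_eq z
  exact ⟨DFinsupp.single n x, S.sumMap_single n x⟩

theorem diffMap_apply_zero (z : S.DirectSum) : S.diffMap z 0 = z 0 := by
  induction z using directSum_induction with
  | zero => simp
  | add f g hf hg => simp [hf, hg]
  | single n x => simp

theorem diffMap_apply_succ (z : S.DirectSum) (k : ℕ) :
    S.diffMap z (k + 1) = z (k + 1) - S.incl (Nat.le_succ k) (z k) := by
  induction z using directSum_induction with
  | zero => simp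
  | add f g hf hg => simp only [map_add, DFinsupp.add_apply, hf, hg]; abel
  | single n x =>
    rw [diffMap_single, DFinsupp.sub_apply]
    rcases eq_or_ne n k with rfl | hk
    · simp
    · rw [DFinsupp.single_eq_of_ne (i := n + 1) (by omega), DFinsupp.single_eq_of_ne (i := n)
        (i' := k) hk.symm, map_zero]

/-- `diffMap` is triangular: the coordinates of a kernel element vanish one after another. -/
theorem diffMap_injective : Function.Injective S.diffMap := by
  refine (injective_iff_map_eq_zero _).2 fun z hz => ?_
  ext k
  induction k with
  | zero => rw [← S.diffMap_apply_zero, hz]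
  | succ k ih =>
    have := S.diffMap_apply_succ z k
    rw [hz, ih] at this
    simpa using this.symm

/-- Modulo the range of `diffMap` a vector may be moved to any later step, so each element is
equivalent to a single summand, which is zero once its sum in `Z` is. -/
theorem exact_diffMap_sumMap : Function.Exact S.diffMap S.sumMap := by
  have hcomp (z : S.DirectSum) : S.sumMap (S.diffMap z) = 0 := by
    induction z using directSum_induction with
    | zero => simp
    | add f g hf hg => simp [hf, hg]
    | single n x => simp [S.toUnion_incl]
  have hshift {n m : ℕ} (h : n ≤ m) (x : S.space n) :
      DFinsupp.single n x - DFinsupp.single m (S.incl h x) ∈ LinearMap.range S.diffMap := by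
    induction m, h using Nat.le_induction with
    | base => simp [incl_refl]
    | succ m h ih =>
      have := add_mem ih ⟨_, S.diffMap_single m (S.incl h x)⟩
      rwa [sub_add_sub_cancel, incl_incl] at this
  have hrep (z : S.DirectSum) : ∃ n x, z - DFinsupp.single n x ∈ LinearMap.range S.diffMap := by
    induction z using directSum_induction with
    | zero => exact ⟨0, 0, by simp⟩
    | add f g hf hg =>
      obtain ⟨n, x, hx⟩ := hf
      obtain ⟨m, y, hy⟩ := hg
      refine ⟨max n m, S.incl (le_max_left n m) x + S.incl (le_max_right n m) y, ?_⟩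
      have := add_mem (add_mem hx (hshift (le_max_left n m) x))
        (add_mem hy (hshift (le_max_right n m) y))
      rwa [sub_add_sub_cancel, sub_add_sub_cancel, sub_add_sub_comm, ← DFinsupp.single_add]
        at this
    | single n x => exact ⟨n, x, by simp⟩
  intro z
  refine ⟨fun hz => ?_, fun ⟨y, hy⟩ => hy ▸ hcomp y⟩
  obtain ⟨n, x, y, hy⟩ := hrep z
  have hx : S.toUnion n x = 0 := by
    rw [← S.sumMap_single, ← sub_sub_cancel z (DFinsupp.single n x), ← hy, map_sub, hz, hcomp,
      sub_zero]
  rw [(map_eq_zero_iff _ (S.injective_toUnion n)).1 hx, DFinsupp.single_zero, sub_zero] at hy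
  exact ⟨y, hy⟩

end DirectSum

/-! ### Necessity: vanishing of `Proj¹` -/

section Proj1

variable {Z : Type u} [AddCommGroup Z] [Module ℂ Z] (S : BanachSpectrum Z)
  (E : Type v) [AddCommGroup E] [Module ℂ E] [TopologicalSpace E] [IsTopologicalAddGroup E]
  [ContinuousSMul ℂ E]

theorem subsingleton_proj1_iff :
    Subsingleton (S.homSpectrum E).Proj1 ↔ ∀ R : ∀ n, S.space n →L[ℂ] E,
      ∃ U : ∀ n, S.space n →L[ℂ] E, ∀ n x,
        R n x = U n x - U (n + 1) (S.incl (Nat.le_succ n) x) := by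
  rw [Submodule.Quotient.subsingleton_iff, LinearMap.range_eq_top]
  refine forall_congr' fun R => exists_congr fun U => ⟨?_, fun h => ?_⟩
  · rintro rfl n x
    rfl
  · funext n
    exact ContinuousLinearMap.ext fun x => (h n x).symm

variable {S E}

/-- Applied to the canonical resolution of an `(LB)`-space by direct sums, weak acyclicity gives
the vanishing of `Proj¹`. -/
theorem subsingleton_proj1_of_isWeaklyAcyclic [LocallyConvexSpace ℝ E] [TopologicalSpace Z]
    (hS : S.IsDefining) (h : IsWeaklyAcyclic E Z) : Subsingleton (S.homSpectrum E).Proj1 := by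
  rw [subsingleton_proj1_iff]
  intro R
  obtain ⟨τ, hτ⟩ := S.directSumSpectrum.exists_isDefining
  have := hτ.1.1.isTopologicalAddGroup
  have := hτ.1.1.continuousSMul
  have := hτ.1.1.locallyConvexSpace
  have := hS.1.1.isTopologicalAddGroup
  have := hS.1.1.continuousSMul
  have := hS.1.1.locallyConvexSpace
  let d : S.DirectSum →L[ℂ] S.DirectSum := ⟨S.diffMap, by
    refine continuous_of_continuous_single hτ _ fun n => ?_
    simp only [diffMap_single]
    exact (continuous_single hτ n).sub
      ((continuous_single hτ (n + 1)).comp (S.incl (Nat.le_succ n)).continuous)⟩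
  let σ : S.DirectSum →L[ℂ] Z := ⟨S.sumMap, by
    refine continuous_of_continuous_single hτ _ fun n => ?_
    simpa only [sumMap_single] using hS.1.2 n⟩
  let f : S.DirectSum →L[ℂ] E := ⟨DFinsupp.lsum ℕ fun n => (R n).toLinearMap, by
    refine continuous_of_continuous_single hτ _ fun n => ?_
    simpa using (R n).continuous⟩
  obtain ⟨T, hT⟩ := h S.DirectSum S.DirectSum d σ (isLBSpace_directSum hτ)
    (isLBSpace_directSum hτ) S.diffMap_injective S.exact_diffMap_sumMap S.sumMap_surjective f
  -- `U n` is the restriction of `T` to the `n`-th summand; `T ∘ d = f` on that summand is the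
  -- required identity.
  refine ⟨fun n => ⟨T.toLinearMap ∘ₗ DFinsupp.lsingle n,
    T.continuous.comp (continuous_single hτ n)⟩, fun n x => ?_⟩
  have h₁ : f (DFinsupp.single n x) = R n x := by
    change DFinsupp.lsum ℕ (fun n => (R n).toLinearMap) (DFinsupp.single n x) = R n x
    simp
  have h₂ : d (DFinsupp.single n x) =
    DFinsupp.single n x - DFinsupp.single (n + 1) (S.incl (Nat.le_succ n) x) :=
    S.diffMap_single n x
  rw [← h₁, ← hT]
  change T (d (DFinsupp.single n x)) = _
  rw [h₂, map_sub]
  rfl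

end Proj1

end BanachSpectrum

/-- Linear maps on a directed family of modules covering `Y` which are compatible with each other
glue to a linear map on `Y`. -/
theorem exists_linearMap_of_directed {P : ℕ → Type*} [∀ n, AddCommGroup (P n)]
    [∀ n, Module ℂ (P n)] {Y E : Type*} [AddCommGroup Y] [Module ℂ Y] [AddCommGroup E]
    [Module ℂ E] (j : ∀ n, P n →ₗ[ℂ] Y) (V : ∀ n, P n →ₗ[ℂ] E)
    (cover : ∀ y, ∃ n p, j n p = y)
    (inj : ∀ n p q, j n p = j n q → V n p = V n q)
    (directed : ∀ {n m}, n ≤ m → ∀ p, ∃ q, j m q = j n p ∧ V m q = V n p) :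
    ∃ W : Y →ₗ[ℂ] E, ∀ n p, W (j n p) = V n p := by
  have compat (n m : ℕ) (p : P n) (q : P m) (h : j n p = j m q) : V n p = V m q := by
    obtain ⟨p', hp', hVp'⟩ := directed (le_max_left n m) p
    obtain ⟨q', hq', hVq'⟩ := directed (le_max_right n m) q
    rw [← hVp', ← hVq']
    exact inj _ _ _ (by rw [hp', hq', h])
  choose N p hp using cover
  refine ⟨{ toFun := fun y => V (N y) (p y), map_add' := fun x y => ?_, map_smul' := fun c x => ?_ },
    fun n q => compat _ _ _ _ (hp _)⟩
  · obtain ⟨q, hq, hVq⟩ := directed (le_max_left (N x) (N y)) (p x)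
    obtain ⟨r, hr, hVr⟩ := directed (le_max_right (N x) (N y)) (p y)
    rw [← hVq, ← hVr, ← map_add]
    exact compat _ _ _ _ (by rw [map_add, hq, hr, hp, hp, hp])
  · rw [RingHom.id_apply, ← map_smul]
    exact compat _ _ _ _ (by rw [map_smul, hp, hp])

/-! ### Extension over a single Banach space -/

section Extension

variable {E : Type v} [AddCommGroup E] [Module ℂ E] [TopologicalSpace E]
  {X Y Z : Type u} [AddCommGroup X] [Module ℂ X] [TopologicalSpace X] [AddCommGroup Y] [Module ℂ Y]
  [TopologicalSpace Y] [AddCommGroup Z] [Module ℂ Z] [TopologicalSpace Z]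
  {ι : X →L[ℂ] Y} {Q : Y →L[ℂ] Z} {A : BanachSpectrum X} {B : BanachSpectrum Y}

/-- A continuous linear map on the kernel of `Q` is continuous for the topology which the kernel
inherits from a step of a spectrum defining the middle space. -/
theorem exists_restrict_ker [T2Space Y] (hA : A.IsDefining) (hB : B.IsDefining)
    [T2Space Z] (hι : Function.Injective ι) (hex : Function.Exact ι Q) (f : X →L[ℂ] E) (k : ℕ) :
    ∃ φ : LinearMap.ker (Q.comp (hB.toUnionL k)).toLinearMap →L[ℂ] E,
      ∀ y x, ι x = B.toUnion k y.1 → φ y = f x := by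
  have : CompleteSpace (LinearMap.ker (Q.comp (hB.toUnionL k)).toLinearMap) :=
    IsClosed.completeSpace_coe (hs := (Q.comp (hB.toUnionL k)).isClosed_ker)
  -- By exactness this Banach kernel lies in the union of the `ι (A n)`, hence factors through one
  -- of them.
  obtain ⟨n, g, hg⟩ := exists_factorization
    ((hB.toUnionL k).comp (LinearMap.ker (Q.comp (hB.toUnionL k)).toLinearMap).subtypeL)
    (fun n => ι.comp (hA.toUnionL n)) (fun n => hι.comp (A.injective_toUnion n)) fun y => by
      obtain ⟨x, hx⟩ := (hex (B.toUnion k y.1)).1 y.2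
      obtain ⟨n, a, rfl⟩ := A.exists_toUnion_eq x
      exact ⟨n, a, hx⟩
  refine ⟨(f.comp (hA.toUnionL n)).comp g, fun y x hx => ?_⟩
  exact congrArg f (hι ((hg y).trans hx.symm))

/-- Extension along the pull-back of an exact sequence of `(LB)`-spaces to an acyclic Banach
space. -/
theorem exists_extension_of_isWeaklyAcyclicBanach [T2Space Y] (hA : A.IsDefining)
    (hB : B.IsDefining) [T2Space Z] (hι : Function.Injective ι) (hex : Function.Exact ι Q)
    (f : X →L[ℂ] E) {H : Type u} [NormedAddCommGroup H] [NormedSpace ℂ H] [CompleteSpace H]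
    (hH : IsWeaklyAcyclicBanach E H) (b : H →L[ℂ] Z) (k : ℕ)
    (hk : ∀ h, ∃ y, Q (B.toUnion k y) = b h) :
    ∃ T : fibreProduct (Q.comp (hB.toUnionL k)) b →L[ℂ] E,
      ∀ p x, p.1.2 = 0 → ι x = B.toUnion k p.1.1 → T p = f x := by
  obtain ⟨φ, hφ⟩ := exists_restrict_ker hA hB hι hex f k
  let F := LinearMap.ker (Q.comp (hB.toUnionL k)).toLinearMap
  have : CompleteSpace F :=
    IsClosed.completeSpace_coe (hs := (Q.comp (hB.toUnionL k)).isClosed_ker)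
  let i : F →L[ℂ] fibreProduct (Q.comp (hB.toUnionL k)) b :=
    fibreProduct.lift _ _ F.subtypeL 0 fun y => by
      rw [zero_apply, map_zero]
      exact y.2
  -- Acyclicity of `H` applied to the pulled-back sequence `0 → F → fibre product → H → 0`; `hk`
  -- gives surjectivity.
  obtain ⟨T, hT⟩ := hH F _ i (fibreProduct.snd _ b)
    (fun y z h => Subtype.ext (congrArg (fun p => p.1.1) h))
    (fun p => ⟨fun h => ⟨⟨p.1.1, by
      change Q (hB.toUnionL k p.1.1) = 0
      rw [fibreProduct.snd_apply] at h
      have := p.2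
      rw [mem_fibreProduct, h, map_zero] at this
      exact this⟩, Subtype.ext (Prod.ext rfl h.symm)⟩, fun ⟨y, hy⟩ => hy ▸ rfl⟩)
    (fun h => by
      obtain ⟨y, hy⟩ := hk h
      exact ⟨⟨(y, h), hy⟩, rfl⟩) φ
  refine ⟨T, fun p x hp hx => ?_⟩
  have hp' : Q (hB.toUnionL k p.1.1) = 0 := by
    have := p.2
    rw [mem_fibreProduct, hp, map_zero] at this
    exact this
  rw [← hφ ⟨p.1.1, hp'⟩ x hx, ← hT]
  exact congrArg T (Subtype.ext (Prod.ext rfl hp))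

end Extension

/-- Every step of a spectrum defining a locally weakly acyclic space maps into that space through
an acyclic Banach space. -/
theorem IsLocallyWeaklyAcyclic.exists_factorization {E : Type v} [AddCommGroup E] [Module ℂ E]
    [TopologicalSpace E] {Z : Type u} [AddCommGroup Z] [Module ℂ Z] [TopologicalSpace Z] [T2Space Z]
    (h : IsLocallyWeaklyAcyclic E Z) {S : BanachSpectrum Z} (hS : S.IsDefining) (n : ℕ) :
    ∃ (H : Type u) (_ : NormedAddCommGroup H) (_ : NormedSpace ℂ H) (_ : CompleteSpace H),
      IsWeaklyAcyclicBanach E H ∧ ∃ (a : S.space n →L[ℂ] H) (b : H →L[ℂ] Z),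
        ∀ x, b (a x) = S.toUnion n x := by
  obtain ⟨W, hW, hfac⟩ := h
  -- This passage from `S` to the distinguished spectrum `W` makes the choice of `S` immaterial.
  obtain ⟨m, g, hg⟩ := hW.exists_factorization (hS.toUnionL n)
  obtain ⟨H, i₁, i₂, i₃, hH, a, b, hab⟩ := hfac m
  refine ⟨H, i₁, i₂, i₃, hH, a.comp g, (hW.toUnionL (m + 1)).comp b, fun x => ?_⟩
  calc W.toUnion (m + 1) (b.comp a (g x)) = S.toUnion n x := by
        rw [← hab, W.toUnion_incl, hg]
        rfl

/-! ### Sufficiency: correcting and gluing the local extensions -/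

section Converse

variable {E : Type v} [AddCommGroup E] [Module ℂ E] [TopologicalSpace E]
  {X Y Z : Type u} [AddCommGroup X] [Module ℂ X] [TopologicalSpace X] [AddCommGroup Y] [Module ℂ Y]
  [TopologicalSpace Y] [AddCommGroup Z] [Module ℂ Z] [TopologicalSpace Z]
  {ι : X →L[ℂ] Y} {Q : Y →L[ℂ] Z} {A : BanachSpectrum X} {B : BanachSpectrum Y}
  {S : BanachSpectrum Z}

/-- In a locally weakly acyclic space, extensions exist over all steps, on large enough steps of
the middle space. -/
theorem IsLocallyWeaklyAcyclic.exists_extension (h : IsLocallyWeaklyAcyclic E Z) [T2Space Y]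
    (hA : A.IsDefining) (hB : B.IsDefining) (hS : S.IsDefining) [T2Space Z]
    (hι : Function.Injective ι) (hex : Function.Exact ι Q) (hQ : Function.Surjective Q)
    (f : X →L[ℂ] E) (n : ℕ) :
    ∃ m, ∀ k, m ≤ k → (∀ w, ∃ y, Q (B.toUnion k y) = S.toUnion n w) ∧
      ∃ T : fibreProduct (Q.comp (hB.toUnionL k)) (hS.toUnionL n) →L[ℂ] E,
        ∀ p x, p.1.2 = 0 → ι x = B.toUnion k p.1.1 → T p = f x := by
  obtain ⟨H, _, _, _, hH, a, b, hab⟩ := h.exists_factorization hS n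
  obtain ⟨m, hm⟩ := exists_forall_exists_eq b (fun m => Q.comp (hB.toUnionL m)) fun z => by
    obtain ⟨y, hy⟩ := hQ (b z)
    obtain ⟨m, y, rfl⟩ := B.exists_toUnion_eq y
    exact ⟨m, y, hy⟩
  refine ⟨m, fun k hk => ?_⟩
  have hm' (z : H) : ∃ y, Q (B.toUnion k y) = b z := by
    obtain ⟨y, hy⟩ := hm z
    exact ⟨B.incl hk y, by rw [B.toUnion_incl, ← hy]; rfl⟩
  refine ⟨fun w => ?_, ?_⟩
  · rw [← hab]
    exact hm' _
  · obtain ⟨T, hT⟩ := exists_extension_of_isWeaklyAcyclicBanach hA hB hι hex f hH b k hm'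
    -- The extension over `H` is pulled back along `a` in the second component.
    refine ⟨T.comp (fibreProduct.lift _ _ (fibreProduct.fst _ _) (a.comp (fibreProduct.snd _ _))
      fun p => p.2.trans (hab _).symm), fun p x hp hx => hT _ x ?_ hx⟩
    exact (congrArg a hp).trans (map_zero a)

/-- If `Proj¹` vanishes, continuous linear maps into `E` extend along every exact sequence of
`(LB)`-spaces ending in a locally weakly acyclic space. -/
theorem IsLocallyWeaklyAcyclic.exists_comp_eq [IsTopologicalAddGroup E] [ContinuousSMul ℂ E]
    [LocallyConvexSpace ℝ E] (h : IsLocallyWeaklyAcyclic E Z) [T2Space Y]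
    (hA : A.IsDefining) (hB : B.IsDefining) (hS : S.IsDefining) [T2Space Z]
    (hι : Function.Injective ι) (hex : Function.Exact ι Q) (hQ : Function.Surjective Q)
    (hproj : Subsingleton (S.homSpectrum E).Proj1) (f : X →L[ℂ] E) :
    ∃ T : Y →L[ℂ] E, T.comp ι = f := by
  choose m hm using h.exists_extension hA hB hS hι hex hQ f
  -- The sum makes `M` monotone and at least `m`; the summand `n` makes it unbounded, so that the `P
  -- n` exhaust `Y`.
  let M (n : ℕ) : ℕ := n + ∑ i ∈ Finset.range (n + 1), m i
  have hmM (n : ℕ) : m n ≤ M n :=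
    (Finset.single_le_sum (f := m) (fun _ _ => Nat.zero_le _) (Finset.self_mem_range_succ n)).trans
      (Nat.le_add_left _ _)
  have hnM (n : ℕ) : n ≤ M n := Nat.le_add_right _ _
  have hMM (n : ℕ) : M n ≤ M (n + 1) := by
    simp only [M, Finset.sum_range_succ _ (n + 1)]
    omega
  have hsurj (n : ℕ) := (hm n (M n) (hmM n)).1
  choose T hT using fun n => (hm n (M n) (hmM n)).2
  let P (n : ℕ) := fibreProduct (Q.comp (hB.toUnionL (M n))) (hS.toUnionL n)
  let t (n : ℕ) : P n →L[ℂ] P (n + 1) := fibreProduct.lift _ _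
    ((B.incl (hMM n)).comp (fibreProduct.fst _ _))
    ((S.incl (Nat.le_succ n)).comp (fibreProduct.snd _ _)) fun p => by
      change Q (B.toUnion _ (B.incl _ p.1.1)) = S.toUnion _ (S.incl _ p.1.2)
      rw [B.toUnion_incl, S.toUnion_incl]
      exact p.2
  have ht₁ (n : ℕ) (p : P n) : B.toUnion _ (t n p).1.1 = B.toUnion _ p.1.1 := B.toUnion_incl _ _
  have ht₂ (n : ℕ) (p : P n) : (t n p).1.2 = S.incl (Nat.le_succ n) p.1.2 := rfl
  have hdesc (n : ℕ) : ∃ R : S.space n →L[ℂ] E, ∀ p : P n, R p.1.2 = T n p - T (n + 1) (t n p) := by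
    refine exists_comp_eq_of_surjective (fibreProduct.snd _ _) (fun w => ?_)
      (T n - (T (n + 1)).comp (t n)) fun p hp => ?_
    · obtain ⟨y, hy⟩ := hsurj n w
      exact ⟨⟨(y, w), hy⟩, rfl⟩
    · rw [fibreProduct.snd_apply] at hp
      have hp' : Q (B.toUnion _ p.1.1) = 0 := by
        have := p.2
        rw [mem_fibreProduct, hp, map_zero] at this
        exact this
      obtain ⟨x, hx⟩ := (hex _).1 hp'
      rw [sub_apply, ContinuousLinearMap.comp_apply, hT n p x hp hx,
        hT (n + 1) (t n p) x (by rw [ht₂, hp, map_zero]) (by rw [ht₁, hx]), sub_self]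
  choose R hR using hdesc
  obtain ⟨U, hU⟩ := (S.subsingleton_proj1_iff E).1 hproj R
  let V (n : ℕ) : P n →L[ℂ] E := T n - (U n).comp (fibreProduct.snd _ _)
  have hV (n : ℕ) (p : P n) : V n p = T n p - U n p.1.2 := rfl
  have hVt (n : ℕ) (p : P n) : V (n + 1) (t n p) = V n p := by
    have := hR n p
    rw [hU] at this
    rw [hV, hV, ht₂, sub_eq_sub_iff_add_eq_add]
    rw [sub_eq_sub_iff_add_eq_add] at this
    rw [add_comm, this, add_comm]
  let j (n : ℕ) : P n →L[ℂ] Y := (hB.toUnionL (M n)).comp (fibreProduct.fst _ _)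
  -- The second component is determined by the first, through its image in `Z`.
  have hj (n : ℕ) : Function.Injective (j n) := fun p q hpq => by
    have h₁ : p.1.1 = q.1.1 := B.injective_toUnion _ hpq
    have h₂ : hS.toUnionL n p.1.2 = hS.toUnionL n q.1.2 := by
      rw [← mem_fibreProduct.1 p.2, ← mem_fibreProduct.1 q.2, h₁]
    exact Subtype.ext (Prod.ext h₁ (S.injective_toUnion n h₂))
  -- Used twice: for `Y` being covered by the `P n`, and for the continuity of the glued map on each
  -- step.
  have hlift (k : ℕ) : ∃ n, ∃ ψ : B.space k →L[ℂ] P n, ∀ y, j n (ψ y) = B.toUnion k y := by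
    obtain ⟨i, g, hg⟩ := hS.exists_factorization (Q.comp (hB.toUnionL k))
    refine ⟨max i k, fibreProduct.lift _ _ (B.incl ((le_max_right i k).trans (hnM _)))
      ((S.incl (le_max_left i k)).comp g) fun y => ?_, fun y => B.toUnion_incl _ _⟩
    have := (hg y).symm
    simpa [B.toUnion_incl, S.toUnion_incl] using this
  obtain ⟨W, hW⟩ := exists_linearMap_of_directed (fun n => (j n).toLinearMap)
    (fun n => (V n).toLinearMap) (fun y => by
      obtain ⟨k, y, rfl⟩ := B.exists_toUnion_eq y
      obtain ⟨n, ψ, hψ⟩ := hlift k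
      exact ⟨n, ψ y, hψ y⟩) (fun n p q hpq => congrArg (V n) (hj n hpq))
    (fun {n m} hnm p => by
      induction m, hnm using Nat.le_induction with
      | base => exact ⟨p, rfl, rfl⟩
      | succ m hnm ih =>
        obtain ⟨q, hq, hVq⟩ := ih
        exact ⟨t m q, (ht₁ m q).trans hq, (hVt m q).trans hVq⟩)
  refine ⟨⟨W, hB.continuous_of_comp W fun k => ?_⟩, ContinuousLinearMap.ext fun x => ?_⟩
  · obtain ⟨n, ψ, hψ⟩ := hlift k
    exact ((V n).continuous.comp ψ.continuous).congr fun y => by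
      rw [← hψ]
      exact (hW n (ψ y)).symm
  · obtain ⟨k, y, hy⟩ := B.exists_toUnion_eq (ι x)
    obtain ⟨n, ψ, hψ⟩ := hlift k
    have hx : ι x = B.toUnion _ (ψ y).1.1 := hy.symm.trans (hψ y).symm
    -- Over `ι x` the second component is zero, so the correction `U n` does not disturb the value
    -- of `f`.
    have hψ0 : (ψ y).1.2 = 0 := by
      refine S.injective_toUnion n ?_
      have := (ψ y).2
      rw [mem_fibreProduct] at this
      rw [map_zero, ← hS.toUnionL_apply, ← this, ContinuousLinearMap.comp_apply,
        hB.toUnionL_apply, ← hx]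
      exact (hex _).2 ⟨x, rfl⟩
    change W (ι x) = f x
    rw [← hy, ← hψ]
    refine (hW n (ψ y)).trans ?_
    change V n (ψ y) = f x
    rw [hV, hψ0, map_zero, sub_zero]
    exact hT n _ x hψ0 hx

end Converse

theorem mainTheorem2
    (E : Type v) [AddCommGroup E] [Module ℂ E] [TopologicalSpace E] [IsTopologicalAddGroup E]
    [ContinuousSMul ℂ E] [LocallyConvexSpace ℝ E] [T2Space E]
    (Z : Type u) [AddCommGroup Z] [Module ℂ Z] [TopologicalSpace Z]
    (hZ : IsLBSpace Z) (hloc : IsLocallyWeaklyAcyclic E Z)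
    (S : BanachSpectrum Z) (hS : S.IsDefining) :
    IsWeaklyAcyclic E Z ↔ Subsingleton (S.homSpectrum E).Proj1 := by
  refine ⟨BanachSpectrum.subsingleton_proj1_of_isWeaklyAcyclic hS, fun hproj => ?_⟩
  rintro X Y _ _ _ _ _ _ ι Q ⟨_, A, hA⟩ ⟨_, B, hB⟩ hι hex hQ f
  have := hZ.1
  exact hloc.exists_comp_eq hA hB hS hι hex hQ hproj f
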